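/- Let $n\ge 2$ and let $B_n$ be Artin's braid group, generated by $\sigma_1,\dots,\sigma_{n-1}$ with relations $\sigma_i\sigma_j=\sigma_j\sigma_i$ for $|i-j|>1$ and $\sigma_i\sigma_j\sigma_i=\sigma_j\sigma_i\sigma_j$ for $|i-j|=1$. A braid is positive if it is a product of generators $\sigma_i$ (without inverses), and $X\preccurlyeq Y$ means that $X^{-1}Y$ is positive. A braid is simple if it is positive and any two of its strands cross at most once. Put $\Delta=\sigma_1(\sigma_2\sigma_1)\cdots(\sigma_{n-1}\cdots\sigma_1)$, $\tau(x)=\Delta^{-1}x\Delta$, $\delta=\sigma_{n-1}\sigma_{n-2}\cdots\sigma_1$, and $\sigma_{[j\to i]}=\sigma_{j-1}\sigma_{j-2}\cdots\sigma_i$ for $1\le i<j\le n$. Braids act on the punctures $1,\dots,n$ from the right: the permutation $\pi_X$ sends $i$ to the endpoint of the strand of $X$ that starts at $i$, and $\pi_{XY}(i)=\pi_Y(\pi_X(i))$; for instance $\pi_{\sigma_1\sigma_2}=(1\;3\;2)$ and $\pi_\delta=(1\;2\cdots n)$. The left normal form of a braid $Y$ is its unique decomposition $Y=\Delta^p y_1\cdots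 y_r$ such that $p\in\mathbb Z$ is maximal with $\Delta^p\preccurlyeq Y$ and each $y_i\neq 1$ is the maximal simple prefix of $y_i\cdots y_r$. Then $\ell(Y)=r$ is the canonical length of $Y$, and $\mathbf c(Y)=\Delta^p y_2\cdots y_r\,\tau^{-p}(y_1)$ is its cycling (with $\mathbf c(Y)=Y$ if $r=0$). The ultra summit set $USS(X)$ is the set of all conjugates $Y$ of $X$ such that $\ell(Y)$ is minimal among the conjugates of $X$ and $\mathbf c^t(Y)=Y$ for some $t\ge 1$. **Proposition.** A braid $s\in B_n$ belongs to $USS(\delta)$ if and only if it is simple and its permutation is a cycle of the form $$\pi_s=(1\;u_1\;u_2\cdots u_r\;n\;d_t\;d_{t-1}\cdots d_1)$$ for some $u_1<u_2<\cdots<u_r$ and some $d_t>d_{t-1}>\cdots>d_1$, with $r,t\ge 0$ and $r+t+2=n$. Moreover, in this case $\alpha^{-1}s\,\alpha=\delta$, where $$\alpha=\sigma_{[d_1\to 1]}\,\sigma_{[d_2\to 1]}\cdots\sigma_{[d_t\to 1]}.$$ -/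

import Mathlib

/-!
Artin's braid group on `n` strands, its classical Garside structure, and ultra summit sets.

All indices are shifted by one so that they start at `0`: punctures (and strands) are the elements
of `Fin n`, so that `i : Fin n` is the puncture usually called `i + 1`, and the generators are
indexed by `Fin (n - 1)`, the generator with index `k` being the one usually called `σ_{k+1}`,
which crosses the strands in the positions `k` and `k + 1` (zero-based).
-/

namespace ArtinBraid

/-- The Artin relations: far generators commute, neighbours satisfy the braid relation. -/
def rels (n : ℕ) : Set (FreeGroup (Fin (n - 1))) :=
  {w | ∃ i j : Fin (n - 1),
    ((i : ℕ) + 1 < j ∧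
      w = (FreeGroup.of i * FreeGroup.of j) * (FreeGroup.of j * FreeGroup.of i)⁻¹) ∨
    ((i : ℕ) + 1 = j ∧
      w = (FreeGroup.of i * FreeGroup.of j * FreeGroup.of i) *
        (FreeGroup.of j * FreeGroup.of i * FreeGroup.of j)⁻¹)}

/-- Artin's braid group on `n` strands, by its classical presentation. -/
abbrev BraidGroup (n : ℕ) : Type := PresentedGroup (rels n)

/-- The Artin generator with (zero-based) index `k`. -/
def gen {n : ℕ} (k : Fin (n - 1)) : BraidGroup n := PresentedGroup.of k

/-- The Artin generator with (zero-based) index `i`, where `i` is a natural number with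
`i < n - 1`; the value `1` for larger `i` is never used. -/
def sigma (n i : ℕ) : BraidGroup n := if h : i < n - 1 then gen ⟨i, h⟩ else 1

/-- For `i ≤ j`, the product `σ_{j-1} σ_{j-2} ⋯ σ_i`, denoted `σ_{[j → i]}`
(the formula is the same for one-based and for zero-based indices). -/
def sigmaDown (n j i : ℕ) : BraidGroup n :=
  ((List.range' i (j - i)).reverse.map (sigma n)).prod

/-- `δ = σ_{n-1} ⋯ σ_2 σ_1` (one-based indices). -/
def delta (n : ℕ) : BraidGroup n := sigmaDown n (n - 1) 0

/-- The Garside element `Δ = σ_1 (σ_2 σ_1) (σ_3 σ_2 σ_1) ⋯ (σ_{n-1} ⋯ σ_1)`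
(one-based indices). -/
def garside (n : ℕ) : BraidGroup n :=
  ((List.range (n - 1)).map fun j => sigmaDown n (j + 1) 0).prod

/-- The transposition of the two neighbouring positions `k` and `k + 1`. -/
def adjSwap {n : ℕ} (k : Fin (n - 1)) : Equiv.Perm (Fin n) :=
  Equiv.swap ⟨k, by omega⟩ ⟨(k : ℕ) + 1, by omega⟩

theorem adjSwap_comm {n : ℕ} {i j : Fin (n - 1)} (h : (i : ℕ) + 1 < j) :
    adjSwap j * adjSwap i = adjSwap i * adjSwap j := by
  apply (Equiv.Perm.Disjoint.commute _).eq
  intro x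
  by_cases hx : (x : ℕ) = j ∨ (x : ℕ) = j + 1
  · right
    apply Equiv.swap_apply_of_ne_of_ne <;> (intro hx'; subst hx'; simp at hx; omega)
  · left
    apply Equiv.swap_apply_of_ne_of_ne <;> (intro hx'; subst hx'; simp at hx)

theorem adjSwap_braid {n : ℕ} {i j : Fin (n - 1)} (h : (i : ℕ) + 1 = j) :
    adjSwap i * (adjSwap j * adjSwap i) = adjSwap j * (adjSwap i * adjSwap j) := by
  ext x
  simp only [adjSwap, Equiv.Perm.mul_apply, Equiv.swap_apply_def, Fin.ext_iff]
  grind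

/-- Braids act on the punctures from the right, so `X ↦ π_X` reverses products when
permutations are composed as functions; this is the corresponding homomorphism to the
opposite of the symmetric group. -/
def permHom (n : ℕ) : BraidGroup n →* (Equiv.Perm (Fin n))ᵐᵒᵖ :=
  PresentedGroup.toGroup (f := fun k => MulOpposite.op (adjSwap k)) (by
    rintro w ⟨i, j, ⟨h, rfl⟩ | ⟨h, rfl⟩⟩
    · simp only [map_mul, map_inv, FreeGroup.lift_apply_of, mul_inv_eq_one]
      rw [← MulOpposite.op_mul, ← MulOpposite.op_mul, adjSwap_comm h]
    · simp only [map_mul, map_inv, FreeGroup.lift_apply_of, mul_inv_eq_one]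
      simp only [← MulOpposite.op_mul]
      rw [adjSwap_braid h])

/-- The permutation `π_X` of the punctures: the strand of `X` that starts at the puncture `i`
ends at the puncture `π_X i`. In a product `X * Y` the braid `X` comes first, that is,
`π_{XY} i = π_Y (π_X i)`. -/
def perm {n : ℕ} (X : BraidGroup n) : Equiv.Perm (Fin n) := (permHom n X).unop

/-- The positive braids: products of Artin generators, without inverses. -/
def positive (n : ℕ) : Submonoid (BraidGroup n) := Submonoid.closure (Set.range gen)

/-- `X ≼ Y`: the braid `X` is a prefix of `Y`. -/
def IsPrefix {n : ℕ} (X Y : BraidGroup n) : Prop := X⁻¹ * Y ∈ positive n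

/-- In the positive word `w` (a list of indices of generators), the number of times that the
strands starting at the positions `a ≠ b` cross each other. The first letter of the word acts
first, and the strands then continue from their new positions. -/
def crossings {n : ℕ} : List (Fin (n - 1)) → Fin n → Fin n → ℕ
  | [], _, _ => 0
  | k :: w, a, b =>
    (if ((a : ℕ) = k ∧ (b : ℕ) = k + 1) ∨ ((b : ℕ) = k ∧ (a : ℕ) = k + 1) then 1 else 0) +
      crossings w (adjSwap k a) (adjSwap k b)

/-- A simple braid: a positive braid in which any two strands cross at most once.
(The number of crossings of two strands is the same in all positive words for a braid, as both
sides of each Artin relation have the same crossings.) -/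
def IsSimple {n : ℕ} (s : BraidGroup n) : Prop :=
  ∃ w : List (Fin (n - 1)), (w.map gen).prod = s ∧
    ∀ a b : Fin n, a ≠ b → crossings w a b ≤ 1

/-- In the list `x_1, …, x_r`, each `x_i` is non-trivial and is the maximal simple prefix of
`x_i ⋯ x_r`. -/
def IsLeftWeighted {n : ℕ} : List (BraidGroup n) → Prop
  | [] => True
  | x :: xs => x ≠ 1 ∧ IsSimple x ∧ IsPrefix x (x * xs.prod) ∧
      (∀ y : BraidGroup n, IsSimple y → IsPrefix y (x * xs.prod) → IsPrefix y x) ∧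
      IsLeftWeighted xs

/-- `X = Δ^p x_1 ⋯ x_r` is the left normal form of `X`: here `p` is the largest exponent with
`Δ^p ≼ X`, and each `x_i ≠ 1` is the maximal simple prefix of `x_i ⋯ x_r`. Every braid on at
least two strands has exactly one left normal form. -/
def IsLeftNormalForm {n : ℕ} (X : BraidGroup n) (p : ℤ) (l : List (BraidGroup n)) : Prop :=
  X = garside n ^ p * l.prod ∧ IsGreatest {q : ℤ | IsPrefix (garside n ^ q) X} p ∧
    IsLeftWeighted l

/-- The inner automorphism `τ(x) = Δ⁻¹ x Δ`. -/
def tau (n : ℕ) : MulAut (BraidGroup n) := MulAut.conj (garside n)⁻¹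

/-- `Y'` is the cycling `c(Y)`: if `Y = Δ^p y_1 ⋯ y_r` is in left normal form then
`c(Y) = Δ^p y_2 ⋯ y_r τ^{-p}(y_1)`, and `c(Y) = Y` in case `r = 0`. -/
def IsCycling {n : ℕ} (Y Y' : BraidGroup n) : Prop :=
  (∃ p : ℤ, IsLeftNormalForm Y p [] ∧ Y' = Y) ∨
  (∃ (p : ℤ) (y : BraidGroup n) (ys : List (BraidGroup n)), IsLeftNormalForm Y p (y :: ys) ∧
    Y' = garside n ^ p * ys.prod * (tau n ^ (-p)) y)

/-- The ultra summit set of `X`: the conjugates `Y` of `X` whose canonical length (the number of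
factors `y_1, …, y_r` in the left normal form) is minimal among all conjugates of `X`, and such
that `c^t(Y) = Y` for some `t ≥ 1`. -/
def USS {n : ℕ} (X : BraidGroup n) : Set (BraidGroup n) :=
  {Y | IsConj X Y ∧
    (∃ (p : ℤ) (l : List (BraidGroup n)), IsLeftNormalForm Y p l ∧
      ∀ (Z : BraidGroup n) (q : ℤ) (m : List (BraidGroup n)),
        IsConj X Z → IsLeftNormalForm Z q m → l.length ≤ m.length) ∧
    Relation.TransGen IsCycling Y Y}

/-- The permutation `π` is the cycle `(1 u_1 ⋯ u_r n d_t ⋯ d_1)` (one-based indices) of length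
`r + t + 2 = n`, where `u = [u_1, …, u_r]` and `d = [d_1, …, d_t]` are increasing
(possibly empty) lists. The cycle sends each entry to the next one, and the last one to the
first. -/
def IsUpDownCycle {n : ℕ} (hn : 2 ≤ n) (π : Equiv.Perm (Fin n)) (u d : List (Fin n)) : Prop :=
  u.Pairwise (· < ·) ∧ d.Pairwise (· < ·) ∧ u.length + d.length + 2 = n ∧
    ((⟨0, by omega⟩ : Fin n) :: u ++ (⟨n - 1, by omega⟩ : Fin n) :: d.reverse).Nodup ∧
    π = ((⟨0, by omega⟩ : Fin n) :: u ++ (⟨n - 1, by omega⟩ : Fin n) :: d.reverse).formPerm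

/-- `α = σ_{[d_1 → 1]} σ_{[d_2 → 1]} ⋯ σ_{[d_t → 1]}` (one-based indices) for
`d = [d_1, …, d_t]`. -/
def alpha {n : ℕ} (d : List (Fin n)) : BraidGroup n :=
  (d.map fun k => sigmaDown n k 0).prod

end ArtinBraid

/-! The proof has two halves: the ultra summit set of `δ` is the set of its simple conjugates, and
the simple conjugates are exactly the braids with an up-down cycle.

The first half counts with the exponent sum, which is conjugation invariant: it is `n - 1` for `δ`,
`n(n-1)/2` for `Δ`, and at most `n(n-1)/2` for any simple braid. For `n ≥ 3` no conjugate of `δ` is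
a power of `Δ`, so the minimal canonical length is 1. A conjugate `Δ^p y` of length 1 must then have
`p = 0`, so it is simple; conversely, a simple conjugate is fixed by cycling. For `n = 2` the group
is generated by `δ = Δ`, which is its own only conjugate (`mem_USS_delta_iff`).

For the second half, a simple conjugate is given by a word of `n - 1` letters whose permutation is
an `n`-cycle. A missing generator would leave an initial segment of punctures invariant, so every
generator occurs exactly once. Commutations bring such a word to the form `UpDownWord`, whose cycle
is read off letter by letter. Conversely, every up-down cycle comes from such a word, a simple braid
is determined by its permutation (`IsSimple.eq_of_perm_eq`), and `α` conjugates the word to `δ`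
(`UpDownWord.mul_alpha`). -/

namespace ArtinBraid

/-! ### Positive words, their braids and permutations. -/

variable {n : ℕ}

/-- The braid of a positive word. -/
def wordBraid (w : List (Fin (n - 1))) : BraidGroup n := (w.map gen).prod

@[simp] theorem wordBraid_nil : wordBraid ([] : List (Fin (n - 1))) = 1 := rfl

@[simp] theorem wordBraid_cons (k : Fin (n - 1)) (w : List (Fin (n - 1))) :
    wordBraid (k :: w) = gen k * wordBraid w := by simp [wordBraid]

@[simp] theorem wordBraid_append (v w : List (Fin (n - 1))) :
    wordBraid (v ++ w) = wordBraid v * wordBraid w := by simp [wordBraid]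

@[simp] theorem perm_one : perm (1 : BraidGroup n) = 1 := by simp [perm]

@[simp] theorem perm_mul (X Y : BraidGroup n) : perm (X * Y) = perm Y * perm X := by
  simp [perm]

@[simp] theorem perm_gen (k : Fin (n - 1)) : perm (gen k) = adjSwap k := by
  simp [perm, permHom, gen]

theorem gen_comm {i j : Fin (n - 1)} (h : (i : ℕ) + 1 < j) : gen i * gen j = gen j * gen i := by
  have := PresentedGroup.one_of_mem (rels := rels n)
    (x := (FreeGroup.of i * FreeGroup.of j) * (FreeGroup.of j * FreeGroup.of i)⁻¹)
    ⟨i, j, Or.inl ⟨h, rfl⟩⟩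
  rw [map_mul, map_inv, mul_inv_eq_one] at this
  simpa [gen, PresentedGroup.of] using this

theorem gen_braid {i j : Fin (n - 1)} (h : (i : ℕ) + 1 = j) :
    gen i * gen j * gen i = gen j * gen i * gen j := by
  have := PresentedGroup.one_of_mem (rels := rels n)
    (x := (FreeGroup.of i * FreeGroup.of j * FreeGroup.of i) *
        (FreeGroup.of j * FreeGroup.of i * FreeGroup.of j)⁻¹)
    ⟨i, j, Or.inr ⟨h, rfl⟩⟩
  rw [map_mul, map_inv, mul_inv_eq_one] at this
  simpa [gen, PresentedGroup.of] using this

/-- The position on the left of the generator with index `k`. -/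
def lo (k : Fin (n - 1)) : Fin n := ⟨k, by omega⟩

/-- The position on the right of the generator with index `k`. -/
def hi (k : Fin (n - 1)) : Fin n := ⟨(k : ℕ) + 1, by omega⟩

theorem val_adjSwap (k : Fin (n - 1)) (x : Fin n) :
    (adjSwap k x : ℕ) = if (x : ℕ) = k then (k : ℕ) + 1 else if (x : ℕ) = k + 1 then k else x := by
  simp only [adjSwap, Equiv.swap_apply_def, Fin.ext_iff]
  split_ifs <;> rfl

@[simp] theorem adjSwap_lo (k : Fin (n - 1)) : adjSwap k (lo k) = hi k := Equiv.swap_apply_left _ _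

@[simp] theorem adjSwap_hi (k : Fin (n - 1)) : adjSwap k (hi k) = lo k := Equiv.swap_apply_right _ _

@[simp] theorem adjSwap_adjSwap (k : Fin (n - 1)) (x : Fin n) : adjSwap k (adjSwap k x) = x :=
  Equiv.swap_apply_self _ _ _

theorem adjSwap_of_ne {k : Fin (n - 1)} {x : Fin n} (h : x ≠ lo k) (h' : x ≠ hi k) :
    adjSwap k x = x := Equiv.swap_apply_of_ne_of_ne h h'

/-! ### A simple braid is determined by its permutation. -/

/-- A word in which every letter, read from the end, creates a new inversion. -/
def IsReduced : List (Fin (n - 1)) → Prop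
  | [] => True
  | k :: w => perm (wordBraid w) (lo k) < perm (wordBraid w) (hi k) ∧ IsReduced w

theorem perm_lt_of_crossings_eq_zero (w : List (Fin (n - 1))) {a b : Fin n} (hab : a < b)
    (h : crossings w a b = 0) : perm (wordBraid w) a < perm (wordBraid w) b := by
  induction w generalizing a b with
  | nil => simpa using hab
  | cons k w ih =>
    simp only [crossings, Nat.add_eq_zero_iff] at h
    simp only [wordBraid_cons, perm_mul, perm_gen, Equiv.Perm.mul_apply]
    refine ih ?_ h.2
    have h1 := h.1
    have := val_adjSwap k a
    have := val_adjSwap k b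
    rw [Fin.lt_def] at hab ⊢
    split_ifs at * <;> grind

theorem crossings_comm (w : List (Fin (n - 1))) (a b : Fin n) :
    crossings w a b = crossings w b a := by
  induction w generalizing a b with
  | nil => rfl
  | cons k w ih =>
    simp only [crossings, ih (adjSwap k a)]
    congr 2
    exact propext or_comm

/-- The two strands exchanged by the first letter have used up their only crossing, so the rest of
the word keeps them in order. -/
theorem isReduced_of_crossings_le_one (w : List (Fin (n - 1)))
    (h : ∀ a b : Fin n, a ≠ b → crossings w a b ≤ 1) : IsReduced w := by
  induction w with
  | nil => trivial
  | cons k w ih =>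
    have hlt : lo k < hi k := by simp [lo, hi, Fin.lt_def]
    constructor
    · apply perm_lt_of_crossings_eq_zero w hlt
      have := h (lo k) (hi k) hlt.ne
      simp only [crossings, adjSwap_lo, adjSwap_hi] at this
      rw [if_pos (by simp [lo, hi]), crossings_comm] at this
      omega
    · apply ih
      intro a b hab
      have := h (adjSwap k a) (adjSwap k b) (by simpa using hab)
      simp only [crossings, adjSwap_adjSwap] at this
      omega

/-- The exchange property, realised by Artin relations: a descent at `k` can be moved to the front,
by commutation if the first letter `j` is far from `k`, and otherwise by rewriting `j k j` as `k j
k`. -/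
theorem exists_eq_gen_mul_of_descent (w : List (Fin (n - 1))) (hw : IsReduced w) (k : Fin (n - 1))
    (hk : perm (wordBraid w) (hi k) < perm (wordBraid w) (lo k)) :
    ∃ v : List (Fin (n - 1)), IsReduced v ∧ v.length + 1 = w.length ∧
      wordBraid w = gen k * wordBraid v := by
  induction hl : w.length using Nat.strong_induction_on generalizing w k with
  | _ l ih =>
  subst hl
  rcases w with _ | ⟨j, v⟩
  · simp [lo, hi, Fin.lt_def] at hk
  obtain ⟨hj, hv⟩ := hw
  have hlen : v.length < (j :: v).length := by simp
  simp only [wordBraid_cons, perm_mul, perm_gen, Equiv.Perm.mul_apply] at hk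
  by_cases hjk : j = k
  · subst hjk
    exact ⟨v, hv, by simp, by simp⟩
  have hjk' : (j : ℕ) ≠ k := fun h => hjk (Fin.ext h)
  by_cases hfar : (j : ℕ) + 1 < k ∨ (k : ℕ) + 1 < j
  · have e1 : adjSwap j (hi k) = hi k := by
      apply adjSwap_of_ne <;> simp [lo, hi, Fin.ext_iff] <;> omega
    have e2 : adjSwap j (lo k) = lo k := by
      apply adjSwap_of_ne <;> simp [lo, hi, Fin.ext_iff] <;> omega
    have e3 : adjSwap k (hi j) = hi j := by
      apply adjSwap_of_ne <;> simp [lo, hi, Fin.ext_iff] <;> omega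
    have e4 : adjSwap k (lo j) = lo j := by
      apply adjSwap_of_ne <;> simp [lo, hi, Fin.ext_iff] <;> omega
    rw [e1, e2] at hk
    obtain ⟨v', hv', hl', he⟩ := ih _ hlen v hv k hk rfl
    refine ⟨j :: v', ⟨?_, hv'⟩, by simp [hl'], ?_⟩
    · simpa [he, e3, e4] using hj
    · rw [wordBraid_cons, wordBraid_cons, he, ← mul_assoc, ← mul_assoc]
      congr 1
      rcases hfar with h | h
      · exact gen_comm h
      · exact (gen_comm h).symm
  · have hadj : (j : ℕ) + 1 = k ∨ (k : ℕ) + 1 = j := by omega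
    -- The first two inequalities are the descents that split off `k` and then `j` from the tail;
    -- the last two make `j :: k :: v''` reduced.
    have key : perm (wordBraid v) (hi k) < perm (wordBraid v) (lo k) ∧
        perm (wordBraid v) (adjSwap k (hi j)) < perm (wordBraid v) (adjSwap k (lo j)) ∧
        perm (wordBraid v) (adjSwap k (adjSwap j (lo k))) <
          perm (wordBraid v) (adjSwap k (adjSwap j (hi k))) ∧
        perm (wordBraid v) (adjSwap k (adjSwap j (adjSwap k (lo j)))) <
          perm (wordBraid v) (adjSwap k (adjSwap j (adjSwap k (hi j)))) := by
      rcases hadj with h | h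
      · have a1 : lo k = hi j := by simp [lo, hi, h]
        have a2 : adjSwap j (hi k) = hi k := by
          apply adjSwap_of_ne <;> simp [lo, hi, Fin.ext_iff] <;> omega
        have a3 : adjSwap k (lo j) = lo j := by
          apply adjSwap_of_ne <;> simp [lo, hi, Fin.ext_iff] <;> omega
        have a4 : adjSwap k (hi j) = hi k := by rw [← a1, adjSwap_lo]
        rw [a1, a2] at hk
        simp only [adjSwap_hi] at hk
        simp only [a1, a2, a3, a4, adjSwap_hi, adjSwap_lo]
        exact ⟨hk.trans hj, hk, hj, hk.trans hj⟩
      · have a1 : hi k = lo j := by simp [lo, hi, h]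
        have a2 : adjSwap j (lo k) = lo k := by
          apply adjSwap_of_ne <;> simp [lo, hi, Fin.ext_iff] <;> omega
        have a3 : adjSwap k (hi j) = hi j := by
          apply adjSwap_of_ne <;> simp [lo, hi, Fin.ext_iff] <;> omega
        have a4 : adjSwap k (lo j) = lo k := by rw [← a1, adjSwap_hi]
        rw [a1, a2] at hk
        simp only [adjSwap_lo] at hk
        simp only [a1, a2, a3, a4, adjSwap_hi, adjSwap_lo]
        exact ⟨hj.trans hk, hk, hj, hj.trans hk⟩
    obtain ⟨k1, k2, k3, k4⟩ := key
    obtain ⟨v', hv', hl', he⟩ := ih _ hlen v hv k k1 rfl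
    rw [he] at k2 k3 k4
    simp only [perm_mul, perm_gen, Equiv.Perm.mul_apply, adjSwap_adjSwap] at k2 k3 k4
    obtain ⟨v'', hv'', hl'', he'⟩ := ih _ (by simp; omega) v' hv' j k2 rfl
    rw [he'] at k3 k4
    simp only [perm_mul, perm_gen, Equiv.Perm.mul_apply, adjSwap_adjSwap] at k3 k4
    refine ⟨j :: k :: v'', ⟨?_, k3, hv''⟩, by simp; omega, ?_⟩
    · simpa using k4
    · rw [wordBraid_cons, wordBraid_cons, wordBraid_cons, he, he']
      simp only [← mul_assoc]
      congr 1
      rcases hadj with h | h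
      · exact gen_braid h
      · exact (gen_braid h).symm

/-- The first letter of `v` is a descent of the common permutation, so it can be stripped from both
words. -/
theorem wordBraid_eq_of_perm_eq (v w : List (Fin (n - 1))) (hv : IsReduced v) (hw : IsReduced w)
    (h : perm (wordBraid v) = perm (wordBraid w)) : wordBraid v = wordBraid w := by
  induction v generalizing w with
  | nil =>
    rcases w with _ | ⟨k, w⟩
    · rfl
    · have h1 := hw.1
      have h2 : ∀ x, perm (wordBraid w) (adjSwap k x) = x := by
        intro x
        simpa using (DFunLike.congr_fun h x).symm
      have h3 := h2 (hi k)
      have h4 := h2 (lo k)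
      rw [adjSwap_hi] at h3
      rw [adjSwap_lo] at h4
      rw [h3, h4] at h1
      simp [lo, hi, Fin.lt_def] at h1
  | cons k v ih =>
    have hk : perm (wordBraid w) (hi k) < perm (wordBraid w) (lo k) := by
      rw [← h]
      simpa using hv.1
    obtain ⟨w', hw', -, he⟩ := exists_eq_gen_mul_of_descent w hw k hk
    rw [he] at h ⊢
    rw [wordBraid_cons, ih w' hv.2 hw' (by simpa using h)]

theorem IsSimple.eq_of_perm_eq {x y : BraidGroup n} (hx : IsSimple x) (hy : IsSimple y)
    (h : perm x = perm y) : x = y := by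
  obtain ⟨v, rfl, hv⟩ := hx
  obtain ⟨w, rfl, hw⟩ := hy
  exact wordBraid_eq_of_perm_eq v w (isReduced_of_crossings_le_one v hv)
    (isReduced_of_crossings_le_one w hw) h

/-! ### Exponent sums of simple braids, `Δ` and `δ`. -/

/-- The exponent sum of a braid. -/
def exponentSum (n : ℕ) : BraidGroup n →* Multiplicative ℤ :=
  PresentedGroup.toGroup (f := fun _ => Multiplicative.ofAdd 1) (by
    rintro w ⟨i, j, ⟨h, rfl⟩ | ⟨h, rfl⟩⟩ <;> simp)

/-- The exponent sum of a braid, as an integer. -/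
def expo (x : BraidGroup n) : ℤ := (exponentSum n x).toAdd

@[simp] theorem expo_one : expo (1 : BraidGroup n) = 0 := by simp [expo]

@[simp] theorem expo_mul (x y : BraidGroup n) : expo (x * y) = expo x + expo y := by simp [expo]

@[simp] theorem expo_inv (x : BraidGroup n) : expo x⁻¹ = -expo x := by simp [expo]

@[simp] theorem expo_zpow (x : BraidGroup n) (p : ℤ) : expo (x ^ p) = p * expo x := by simp [expo]

@[simp] theorem expo_gen (k : Fin (n - 1)) : expo (gen k) = 1 := by
  simp [expo, exponentSum, gen]

@[simp] theorem expo_wordBraid (w : List (Fin (n - 1))) : expo (wordBraid w) = w.length := by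
  induction w with
  | nil => simp
  | cons k w ih => simp [ih]; ring

theorem expo_eq_of_isConj {x y : BraidGroup n} (h : IsConj x y) : expo x = expo y := by
  obtain ⟨c, rfl⟩ := isConj_iff.1 h
  simp

theorem expo_nonneg_of_mem_positive {x : BraidGroup n} (h : x ∈ positive n) : 0 ≤ expo x := by
  induction h using Submonoid.closure_induction with
  | mem x hx => obtain ⟨k, rfl⟩ := hx; simp
  | one => simp
  | mul x y _ _ hx hy => simp; omega

theorem IsPrefix.expo_le {x y : BraidGroup n} (h : IsPrefix x y) : expo x ≤ expo y := by
  have := expo_nonneg_of_mem_positive h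
  simp at this
  omega

theorem wordBraid_mem_positive (w : List (Fin (n - 1))) : wordBraid w ∈ positive n :=
  Submonoid.list_prod_mem _ (by
    intro x hx
    obtain ⟨k, -, rfl⟩ := List.mem_map.1 hx
    exact Submonoid.subset_closure ⟨k, rfl⟩)

/-- Each letter crosses exactly one pair of strands, and the sum counts that pair in both orders. -/
theorem sum_crossings (w : List (Fin (n - 1))) :
    ∑ a : Fin n, ∑ b : Fin n, crossings w a b = 2 * w.length := by
  induction w with
  | nil => simp [crossings]
  | cons k w ih =>
    simp only [crossings, Finset.sum_add_distrib, List.length_cons]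
    have h1 : ∑ a : Fin n, ∑ b : Fin n, crossings w (adjSwap k a) (adjSwap k b) =
        ∑ a : Fin n, ∑ b : Fin n, crossings w a b := by
      rw [← Equiv.sum_comp (adjSwap k) (fun a => ∑ b, crossings w a b)]
      exact Finset.sum_congr rfl fun a _ => Equiv.sum_comp (adjSwap k) _
    have h2 : ∀ a b : Fin n, (if ((a : ℕ) = k ∧ (b : ℕ) = k + 1) ∨ ((b : ℕ) = k ∧ (a : ℕ) = k + 1)
        then 1 else 0) = (if a = lo k then (if b = hi k then 1 else 0) else 0) +
          (if a = hi k then (if b = lo k then 1 else 0) else 0) := by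
      intro a b
      simp only [lo, hi, Fin.ext_iff]
      split_ifs <;> omega
    rw [h1, ih]
    simp only [h2, Finset.sum_add_distrib]
    simp [Finset.sum_ite_eq', Finset.sum_ite_irrel]
    ring

theorem crossings_self (w : List (Fin (n - 1))) (a : Fin n) : crossings w a a = 0 := by
  induction w generalizing a with
  | nil => rfl
  | cons k w ih => simp [crossings, ih]; omega

theorem IsSimple.two_mul_expo_le {x : BraidGroup n} (hx : IsSimple x) :
    2 * expo x ≤ n * (n - 1) := by
  obtain ⟨w, rfl, hw⟩ := hx
  have h : ∑ a : Fin n, ∑ b : Fin n, crossings w a b ≤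
      ∑ a : Fin n, ∑ b : Fin n, if a = b then 0 else 1 := by
    refine Finset.sum_le_sum fun a _ => Finset.sum_le_sum fun b _ => ?_
    split_ifs with hab
    · rw [hab, crossings_self]
    · exact hw a b hab
  have h3 : ∀ a : Fin n, ∑ b : Fin n, (if a = b then 0 else 1) = n - 1 := by
    intro a
    simp [Finset.sum_ite, Finset.filter_ne, Finset.card_erase_of_mem]
  rw [sum_crossings, Finset.sum_congr rfl fun a _ => h3 a] at h
  change 2 * expo (wordBraid w) ≤ _
  rw [expo_wordBraid]
  simp only [Finset.sum_const, Finset.card_univ, Fintype.card_fin, smul_eq_mul] at h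
  -- The truncated `n - 1` agrees with the integer one only for positive `n`.
  rcases n with _ | n
  · rcases w with _ | ⟨k, w⟩
    · simp
    · exact k.elim0
  · push_cast
    simp at h ⊢
    exact_mod_cast h

theorem sigma_of_lt {i : ℕ} (h : i < n - 1) : sigma n i = gen ⟨i, h⟩ := dif_pos h

@[simp] theorem sigmaDown_zero : sigmaDown n 0 0 = 1 := by simp [sigmaDown]

theorem sigmaDown_succ (m : ℕ) : sigmaDown n (m + 1) 0 = sigma n m * sigmaDown n m 0 := by
  simp [sigmaDown, List.range'_1_concat]

theorem expo_sigmaDown {m : ℕ} (hm : m ≤ n - 1) : expo (sigmaDown n m 0) = m := by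
  induction m with
  | zero => simp
  | succ m ih =>
    rw [sigmaDown_succ, expo_mul, ih (by omega), sigma_of_lt (by omega)]
    simp; ring

theorem two_mul_expo_garside (hn : 1 ≤ n) : 2 * expo (garside n) = n * (n - 1) := by
  have key : ∀ m ≤ n - 1, 2 * expo (((List.range m).map fun j => sigmaDown n (j + 1) 0).prod) =
      (m + 1) * m := by
    intro m
    induction m with
    | zero => simp
    | succ m ih =>
      intro hm
      rw [List.range_succ, List.map_append, List.prod_append, expo_mul, mul_add, ih (by omega)]
      simp only [List.map_cons, List.map_nil, List.prod_cons, List.prod_nil, mul_one]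
      rw [expo_sigmaDown hm]
      push_cast
      ring
  rw [garside, key _ le_rfl]
  push_cast [hn]
  ring

theorem expo_delta (hn : 1 ≤ n) : expo (delta n) = n - 1 := by
  rw [delta, expo_sigmaDown le_rfl]
  push_cast [hn]
  ring

/-! ### Inserting an entry into a cycle. -/

theorem _root_.List.formPerm_append_cons_cons_left {α : Type*} [DecidableEq α] (l r : List α)
    (a b : α) (h : (l ++ b :: a :: r).Nodup) :
    (l ++ b :: a :: r).formPerm = Equiv.swap a b * (l ++ a :: r).formPerm := by
  have h1 : (l ++ b :: a :: r) ~r (b :: a :: (r ++ l)) := by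
    simpa using List.isRotated_append (l := l) (l' := b :: a :: r)
  have h2 : (l ++ a :: r) ~r (a :: (r ++ l)) := by
    simpa using List.isRotated_append (l := l) (l' := a :: r)
  have h' : (l ++ a :: r).Nodup := h.sublist (by simp)
  rw [List.formPerm_eq_of_isRotated h h1, List.formPerm_eq_of_isRotated h' h2,
    List.formPerm_cons_cons, Equiv.swap_comm]

/-- Reversing the list inverts the cycle, which turns insertion before `a` into insertion after `a`.
-/
theorem _root_.List.formPerm_append_cons_cons_right {α : Type*} [DecidableEq α] (l r : List α)
    (a b : α) (h : (l ++ a :: b :: r).Nodup) :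
    (l ++ a :: b :: r).formPerm = (l ++ a :: r).formPerm * Equiv.swap a b := by
  have := List.formPerm_append_cons_cons_left r.reverse l.reverse a b
    (by simpa using List.nodup_reverse.2 h)
  have e1 : (r.reverse ++ b :: a :: l.reverse) = (l ++ a :: b :: r).reverse := by simp
  have e2 : (r.reverse ++ a :: l.reverse) = (l ++ a :: r).reverse := by simp
  rw [e1, e2, List.formPerm_reverse, List.formPerm_reverse] at this
  rw [← inv_inj, this]
  simp

theorem _root_.List.Nodup.mem_of_length_eq {l : List (Fin n)} (hl : l.Nodup) (h : l.length = n)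
    (x : Fin n) : x ∈ l := by
  have : l.toFinset = Finset.univ := Finset.eq_univ_of_card _ (by
    rw [List.toFinset_card_of_nodup hl, h, Fintype.card_fin])
  rw [← List.mem_toFinset, this]
  exact Finset.mem_univ x

/-! ### Words using each generator once, and their cycles. -/

/-- Words using each of the first `m` generators exactly once, built by adding the next generator
at the front (recorded in the list of ascending entries of the cycle) or at the end (recorded in
the list of descending entries). -/
inductive UpDownWord {n : ℕ} : ℕ → List (Fin (n - 1)) → List (Fin n) → List (Fin n) → Prop
  | base (h : 0 < n - 1) : UpDownWord 1 [⟨0, h⟩] [] []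
  | up {m : ℕ} {w : List (Fin (n - 1))} {u d : List (Fin n)} (h : m < n - 1) :
      UpDownWord m w u d → UpDownWord (m + 1) (⟨m, h⟩ :: w) (u ++ [lo ⟨m, h⟩]) d
  | down {m : ℕ} {w : List (Fin (n - 1))} {u d : List (Fin n)} (h : m < n - 1) :
      UpDownWord m w u d → UpDownWord (m + 1) (w ++ [⟨m, h⟩]) u (d ++ [lo ⟨m, h⟩])

namespace UpDownWord

variable {m : ℕ} {w : List (Fin (n - 1))} {u d : List (Fin n)}

theorem pos (h : UpDownWord m w u d) : 0 < m := by cases h <;> omega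

theorem lt_of_mem (h : UpDownWord m w u d) {k : Fin (n - 1)} (hk : k ∈ w) : (k : ℕ) < m := by
  induction h with
  | base => simp_all
  | up _ _ ih => simp at hk; rcases hk with rfl | hk <;> grind
  | down _ _ ih => simp at hk; rcases hk with hk | rfl <;> grind

theorem up_mem (h : UpDownWord m w u d) {x : Fin n} (hx : x ∈ u) : 0 < (x : ℕ) ∧ (x : ℕ) < m := by
  induction h with
  | base => simp at hx
  | up _ h ih =>
    have := h.pos
    simp at hx; rcases hx with hx | rfl
    · have := ih hx; omega
    · simp [lo]; omega
  | down _ _ ih => have := ih hx; omega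

theorem down_mem (h : UpDownWord m w u d) {x : Fin n} (hx : x ∈ d) :
    0 < (x : ℕ) ∧ (x : ℕ) < m := by
  induction h with
  | base => simp at hx
  | up _ _ ih => have := ih hx; omega
  | down _ h ih =>
    have := h.pos
    simp at hx; rcases hx with hx | rfl
    · have := ih hx; omega
    · simp [lo]; omega

theorem pairwise_up (h : UpDownWord m w u d) : u.Pairwise (· < ·) := by
  induction h with
  | base => simp
  | up _ h ih =>
    rw [List.pairwise_append]
    exact ⟨ih, by simp, fun x hx y hy => by
      simp at hy; subst hy; exact (h.up_mem hx).2⟩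
  | down _ h ih => exact ih

theorem pairwise_down (h : UpDownWord m w u d) : d.Pairwise (· < ·) := by
  induction h with
  | base => simp
  | up _ h ih => exact ih
  | down _ h ih =>
    rw [List.pairwise_append]
    exact ⟨ih, by simp, fun x hx y hy => by
      simp at hy; subst hy; exact (h.down_mem hx).2⟩

theorem length_add_length (h : UpDownWord m w u d) : u.length + d.length + 1 = m := by
  induction h with
  | base => simp
  | up _ h ih => simp; omega
  | down _ h ih => simp; omega

theorem disjoint (h : UpDownWord m w u d) : ∀ x ∈ u, x ∉ d := by
  induction h with
  | base => simp
  | up _ h ih =>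
    intro x hx hd
    simp at hx; rcases hx with hx | rfl
    · exact ih x hx hd
    · simpa [lo] using (h.down_mem hd).2
  | down _ h ih =>
    intro x hx hd
    simp at hd; rcases hd with hd | rfl
    · exact ih x hx hd
    · simpa [lo] using (h.up_mem hx).2

theorem nodup_cycle (h : UpDownWord m w u d) (h0 : 0 < n) (hm : m < n) :
    ((⟨0, h0⟩ : Fin n) :: u ++ (⟨m, hm⟩ : Fin n) :: d.reverse).Nodup := by
  have := h.pos
  rw [List.nodup_append, List.nodup_cons, List.nodup_cons]
  refine ⟨⟨fun hx => ?_, h.pairwise_up.imp fun hxy => hxy.ne⟩, ⟨fun hx => ?_,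
    List.nodup_reverse.2 (h.pairwise_down.imp fun hxy => hxy.ne)⟩, ?_⟩
  · simpa using (h.up_mem hx).1
  · simpa using (h.down_mem (List.mem_reverse.1 hx)).2
  · intro x hx y hy hxy
    subst hxy
    simp only [List.mem_cons, List.mem_reverse] at hx hy
    rcases hx with rfl | hx <;> rcases hy with hy | hy
    · simp at hy; omega
    · simpa using (h.down_mem hy).1
    · subst hy; simpa using (h.up_mem hx).2
    · exact h.disjoint _ hx hy

/-- The new letter multiplies by the transposition of `m` and `m + 1`. At the front of the word it
inserts `m + 1` just after `m` in the cycle, at the end just before `m`; so `m` becomes the last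
ascending or the first descending entry after the maximum. -/
theorem perm_eq (h : UpDownWord m w u d) (h0 : 0 < n) (hm : m < n) :
    perm (wordBraid w) =
      ((⟨0, h0⟩ : Fin n) :: u ++ (⟨m, hm⟩ : Fin n) :: d.reverse).formPerm := by
  induction h with
  | base h => simp; rfl
  | @up m w u d h hw ih =>
    have := (UpDownWord.up h hw).nodup_cycle h0 hm
    simp only [List.cons_append, List.append_assoc, List.nil_append] at this ⊢
    rw [← List.cons_append] at this ⊢
    rw [List.formPerm_append_cons_cons_right _ _ _ _ this, wordBraid_cons, perm_mul, perm_gen,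
      ih (by omega)]
    rfl
  | @down m w u d h hw ih =>
    have := (UpDownWord.down h hw).nodup_cycle h0 hm
    simp only [List.reverse_append, List.reverse_cons, List.reverse_nil, List.nil_append,
      List.cons_append] at this ⊢
    rw [← List.cons_append] at this ⊢
    rw [List.formPerm_append_cons_cons_left _ _ _ _ this, wordBraid_append, perm_mul,
      wordBraid_cons, wordBraid_nil, mul_one, perm_gen, ih (by omega)]
    rfl

end UpDownWord

theorem perm_apply_of_forall_lt (w : List (Fin (n - 1))) {x : Fin n}
    (h : ∀ k ∈ w, (k : ℕ) + 1 < x) : perm (wordBraid w) x = x := by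
  induction w with
  | nil => simp
  | cons k w ih =>
    have h1 := h k (by simp)
    have : adjSwap k x = x := Fin.ext (by rw [val_adjSwap]; split_ifs <;> omega)
    simp [this, ih fun j hj => h j (by simp [hj])]

theorem crossings_of_forall_lt (w : List (Fin (n - 1))) {x : Fin n}
    (h : ∀ k ∈ w, (k : ℕ) + 1 < x) (a : Fin n) : crossings w a x = 0 := by
  induction w generalizing a with
  | nil => rfl
  | cons k w ih =>
    have h1 := h k (by simp)
    have : adjSwap k x = x := Fin.ext (by rw [val_adjSwap]; split_ifs <;> omega)
    simp [crossings, this, ih fun j hj => h j (by simp [hj])]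
    omega

theorem crossings_append (v w : List (Fin (n - 1))) (a b : Fin n) :
    crossings (v ++ w) a b =
      crossings v a b + crossings w (perm (wordBraid v) a) (perm (wordBraid v) b) := by
  induction v generalizing a b with
  | nil => simp [crossings]
  | cons k v ih => simp [crossings, ih, add_assoc]

namespace UpDownWord

variable {m : ℕ} {w : List (Fin (n - 1))} {u d : List (Fin n)}

/-- One of the two strands meeting at the new letter lies at the position `m + 1` throughout `w`,
out of reach of its letters, so these two strands do not cross again. -/
theorem crossings_le_one (h : UpDownWord m w u d) (a b : Fin n) : crossings w a b ≤ 1 := by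
  induction h generalizing a b with
  | base h => simp only [crossings]; split_ifs <;> omega
  | @up m w u d h hw ih =>
    have key : ∀ a, crossings w a (hi ⟨m, h⟩) = 0 :=
      crossings_of_forall_lt w fun k hk => by simpa [hi] using hw.lt_of_mem hk
    simp only [crossings]
    split_ifs with hc
    · rcases hc with ⟨ha, hb⟩ | ⟨hb, ha⟩
      · have : adjSwap ⟨m, h⟩ a = hi ⟨m, h⟩ := by
          rw [← adjSwap_lo]; congr 1; exact Fin.ext ha
        rw [this, crossings_comm, key]
      · have : adjSwap ⟨m, h⟩ b = hi ⟨m, h⟩ := by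
          rw [← adjSwap_lo]; congr 1; exact Fin.ext hb
        rw [this, key]
    · simpa using ih _ _
  | @down m w u d h hw ih =>
    have hlt : ∀ k ∈ w, (k : ℕ) + 1 < (hi ⟨m, h⟩ : Fin n) :=
      fun k hk => by simpa [hi] using hw.lt_of_mem hk
    have key := crossings_of_forall_lt w hlt
    have hfix := perm_apply_of_forall_lt w hlt
    rw [crossings_append]
    simp only [crossings]
    split_ifs with hc
    · rcases hc with ⟨ha, hb⟩ | ⟨hb, ha⟩
      · have : b = hi ⟨m, h⟩ := by
          apply (perm (wordBraid w)).injective; rw [hfix]; exact Fin.ext hb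
        rw [this, key]
      · have : a = hi ⟨m, h⟩ := by
          apply (perm (wordBraid w)).injective; rw [hfix]; exact Fin.ext ha
        rw [this, crossings_comm, key]
    · simpa using ih _ _

theorem isSimple (h : UpDownWord m w u d) : IsSimple (wordBraid w) :=
  ⟨w, rfl, fun a b _ => h.crossings_le_one a b⟩

end UpDownWord

/-! ### Conjugation by `α`. -/

theorem commute_sigmaDown {k j : ℕ} (hkj : j < k) (hk : k < n - 1) :
    Commute (sigma n k) (sigmaDown n j 0) := by
  induction j with
  | zero => simp
  | succ j ih =>
    rw [sigmaDown_succ]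
    refine Commute.mul_right ?_ (ih (by omega))
    rw [sigma_of_lt hk, sigma_of_lt (by omega)]
    exact (gen_comm (by simpa using hkj)).symm

theorem commute_alpha {k : ℕ} (hk : k < n - 1) {d : List (Fin n)} (hd : ∀ x ∈ d, (x : ℕ) < k) :
    Commute (sigma n k) (alpha d) := by
  apply Commute.list_prod_right
  intro x hx
  obtain ⟨y, hy, rfl⟩ := List.mem_map.1 hx
  obtain ⟨z, hz, hyz⟩ := List.mem_flatMap.1 hy
  rw [List.mem_singleton.1 hyz]
  exact commute_sigmaDown (hd z hz) hk

theorem alpha_concat (d : List (Fin n)) (x : Fin n) :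
    alpha (d ++ [x]) = alpha d * sigmaDown n x 0 := by simp [alpha]

namespace UpDownWord

variable {m : ℕ} {w : List (Fin (n - 1))} {u d : List (Fin n)}

/-- The new generator commutes with the old `α`, whose letters have index at most `m - 2`. An
ascending step thus just extends the descending product; a descending step supplies the extra factor
`sigmaDown n m 0` through `α`. -/
theorem mul_alpha (h : UpDownWord m w u d) :
    wordBraid w * alpha d = alpha d * sigmaDown n m 0 := by
  induction h with
  | base h => simp [alpha, sigmaDown_succ, sigma_of_lt h]
  | @up m w u d h hw ih =>
    have := commute_alpha h fun x hx => (hw.down_mem hx).2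
    rw [sigmaDown_succ, wordBraid_cons, mul_assoc, ih, ← mul_assoc, ← mul_assoc, ← this.eq,
      sigma_of_lt h]
  | @down m w u d h hw ih =>
    have := commute_alpha h fun x hx => (hw.down_mem hx).2
    rw [sigma_of_lt h] at this
    rw [sigmaDown_succ, alpha_concat, sigma_of_lt h]
    change _ * (_ * sigmaDown n m 0) = _ * sigmaDown n m 0 * _
    rw [wordBraid_append, wordBraid_cons, wordBraid_nil, mul_one, ← mul_assoc,
      mul_assoc _ (gen _), this.eq, ← mul_assoc, ih]
    simp only [mul_assoc]

end UpDownWord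

/-! ### Existence of up-down words for given letters or given cycles. -/

theorem commute_gen_wordBraid {k : Fin (n - 1)} {w : List (Fin (n - 1))}
    (h : ∀ j ∈ w, (j : ℕ) + 1 < k) : Commute (gen k) (wordBraid w) := by
  apply Commute.list_prod_right
  intro x hx
  obtain ⟨j, hj, rfl⟩ := List.mem_map.1 hx
  exact (gen_comm (h j hj)).symm

/-- Among the smaller generators only the one with index `m - 1` may fail to commute with the one
with index `m`. As it occurs once, the largest letter can be pushed away from it, to the front or to
the end. -/
theorem exists_upDownWord_of_nodup (m : ℕ) (hm : 1 ≤ m) (hmn : m ≤ n - 1)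
    (w : List (Fin (n - 1))) (hw : w.Nodup) (hmem : ∀ k : Fin (n - 1), k ∈ w ↔ (k : ℕ) < m) :
    ∃ w' u d, UpDownWord m w' u d ∧ wordBraid w' = wordBraid w := by
  induction m, hm using Nat.le_induction generalizing w with
  | base =>
    refine ⟨_, _, _, UpDownWord.base (by omega), ?_⟩
    have : w.Perm [⟨0, by omega⟩] := by
      rw [List.perm_ext_iff_of_nodup hw (by simp)]
      intro k
      rw [hmem]
      simp [Fin.ext_iff]
    rw [List.perm_singleton.1 this]
  | succ m hm ih =>
    have hm' : m < n - 1 := by omega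
    obtain ⟨v₁, v₂, rfl⟩ := List.append_of_mem ((hmem ⟨m, hm'⟩).2 (by simp))
    have hnd := List.nodup_middle.1 hw
    rw [List.nodup_cons] at hnd
    have hv : ∀ k : Fin (n - 1), k ∈ v₁ ++ v₂ ↔ (k : ℕ) < m := by
      intro k
      have h1 := hmem k
      by_cases hk : k = ⟨m, hm'⟩
      · subst hk
        simpa using hnd.1
      · have : (k : ℕ) ≠ m := fun h => hk (Fin.ext h)
        simp only [List.mem_append, List.mem_cons, hk, false_or] at h1 ⊢
        rw [h1]; omega
    obtain ⟨w', u, d, h', he⟩ := ih (by omega) (v₁ ++ v₂) hnd.2 hv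
    by_cases h2 : (⟨m - 1, by omega⟩ : Fin (n - 1)) ∈ v₂
    · have h1 : (⟨m - 1, by omega⟩ : Fin (n - 1)) ∉ v₁ := fun h1 =>
        (List.nodup_append.1 hnd.2).2.2 _ h1 _ h2 rfl
      have hc : Commute (gen ⟨m, hm'⟩) (wordBraid v₁) := commute_gen_wordBraid fun j hj => by
        have := (hv j).1 (by simp [hj])
        have : (j : ℕ) ≠ m - 1 := fun h => h1 (by convert hj; exact h.symm)
        simp; omega
      refine ⟨_, _, _, h'.up hm', ?_⟩
      rw [wordBraid_cons, he, wordBraid_append, wordBraid_append, wordBraid_cons, ← mul_assoc,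
        hc.eq, mul_assoc]
    · have hc : Commute (gen ⟨m, hm'⟩) (wordBraid v₂) := commute_gen_wordBraid fun j hj => by
        have := (hv j).1 (by simp [hj])
        have : (j : ℕ) ≠ m - 1 := fun h => h2 (by convert hj; exact h.symm)
        simp; omega
      refine ⟨_, _, _, h'.down hm', ?_⟩
      rw [wordBraid_append, he, wordBraid_append, wordBraid_append, wordBraid_cons,
        wordBraid_cons, hc.eq, wordBraid_nil, mul_one, mul_assoc]

theorem eq_concat_of_pairwise_lt {l : List (Fin n)} (hl : l.Pairwise (· < ·)) {x : Fin n}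
    (hx : x ∈ l) (hmax : ∀ y ∈ l, y ≤ x) : ∃ l', l = l' ++ [x] := by
  obtain ⟨l₁, l₂, rfl⟩ := List.append_of_mem hx
  rcases l₂ with _ | ⟨y, l₂⟩
  · exact ⟨l₁, rfl⟩
  · rw [List.pairwise_append, List.pairwise_cons] at hl
    exact absurd (hl.2.1.1 y (by simp)) (not_lt.2 (hmax y (by simp)))

/-- The largest entry ends one of the two increasing lists, and which one tells on which side the
last letter was added. -/
theorem exists_upDownWord_of_pairwise (m : ℕ) (hm : 1 ≤ m) (hmn : m ≤ n - 1)
    (u d : List (Fin n)) (hu : u.Pairwise (· < ·)) (hd : d.Pairwise (· < ·))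
    (hud : ∀ x ∈ u, x ∉ d) (hmem : ∀ x : Fin n, (x ∈ u ∨ x ∈ d) ↔ 0 < (x : ℕ) ∧ (x : ℕ) < m) :
    ∃ w, UpDownWord m w u d := by
  induction m, hm using Nat.le_induction generalizing u d with
  | base =>
    have hu : u = [] := List.eq_nil_iff_forall_not_mem.2 fun x hx => by
      have := (hmem x).1 (Or.inl hx); omega
    have hd : d = [] := List.eq_nil_iff_forall_not_mem.2 fun x hx => by
      have := (hmem x).1 (Or.inr hx); omega
    subst hu hd
    exact ⟨_, UpDownWord.base (by omega)⟩
  | succ m hm ih =>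
    have hm' : m < n - 1 := by omega
    have hlo : ((lo ⟨m, hm'⟩ : Fin n) : ℕ) = m := rfl
    rcases (hmem (lo ⟨m, hm'⟩)).2 (by omega) with hx | hx
    · obtain ⟨u', rfl⟩ := eq_concat_of_pairwise_lt hu hx fun y hy => by
        have := (hmem y).1 (Or.inl hy)
        rw [Fin.le_def]; omega
      rw [List.pairwise_append] at hu
      obtain ⟨w, hw⟩ := ih (by omega) u' d hu.1 hd (fun x hx => hud x (by simp [hx])) (by
        intro x
        have h1 := hmem x
        by_cases hxm : x = lo ⟨m, hm'⟩
        · have hu' : x ∉ u' := fun h => (hu.2.2 x h (lo ⟨m, hm'⟩) (by simp)).ne hxm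
          have hd' : x ∉ d := hud x (by simp [hxm])
          simp only [hu', hd', or_self, false_iff]
          rw [hxm]; omega
        · have : (x : ℕ) ≠ m := fun h => hxm (Fin.ext h)
          simp [hxm] at h1
          rw [h1]; omega)
      exact ⟨_, hw.up hm'⟩
    · obtain ⟨d', rfl⟩ := eq_concat_of_pairwise_lt hd hx fun y hy => by
        have := (hmem y).1 (Or.inr hy)
        rw [Fin.le_def]; omega
      rw [List.pairwise_append] at hd
      obtain ⟨w, hw⟩ := ih (by omega) u d' hu hd.1
        (fun x hx h => hud x hx (by simp [h])) (by
        intro x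
        have h1 := hmem x
        by_cases hxm : x = lo ⟨m, hm'⟩
        · have hd' : x ∉ d' := fun h => (hd.2.2 x h (lo ⟨m, hm'⟩) (by simp)).ne hxm
          have hu' : x ∉ u := fun h => hud x h (by simp [hxm])
          simp only [hu', hd', or_self, false_iff]
          rw [hxm]; omega
        · have : (x : ℕ) ≠ m := fun h => hxm (Fin.ext h)
          simp [hxm] at h1
          rw [h1]; omega)
      exact ⟨_, hw.down hm'⟩

theorem UpDownWord.isUpDownCycle {w : List (Fin (n - 1))} {u d : List (Fin n)}
    (h : UpDownWord (n - 1) w u d) (hn : 2 ≤ n) :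
    IsUpDownCycle hn (perm (wordBraid w)) u d :=
  ⟨h.pairwise_up, h.pairwise_down, by have := h.length_add_length; omega,
    h.nodup_cycle _ _, h.perm_eq _ _⟩

theorem IsUpDownCycle.exists_upDownWord {hn : 2 ≤ n} {π : Equiv.Perm (Fin n)}
    {u d : List (Fin n)} (h : IsUpDownCycle hn π u d) : ∃ w, UpDownWord (n - 1) w u d := by
  obtain ⟨hu, hd, hlen, hnd, -⟩ := h
  have hall : ∀ x : Fin n, x ∈ (⟨0, by omega⟩ : Fin n) :: u ++ (⟨n - 1, by omega⟩ : Fin n) ::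
      d.reverse :=
    hnd.mem_of_length_eq (by simp; omega)
  rw [List.nodup_append, List.nodup_cons, List.nodup_cons] at hnd
  obtain ⟨⟨h1, -⟩, ⟨h2, -⟩, h3⟩ := hnd
  simp only [List.mem_reverse, List.mem_cons] at h2 h3
  refine exists_upDownWord_of_pairwise (n - 1) (by omega) le_rfl u d hu hd
    (fun x hx hx' => h3 x (Or.inr hx) x (Or.inr hx') rfl) fun x => ⟨fun hx => ?_, fun hx => ?_⟩
  · have h0 : (x : ℕ) ≠ 0 := by
      intro h0
      have : x = ⟨0, by omega⟩ := Fin.ext h0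
      rw [this] at hx
      rcases hx with hx | hx
      · exact h1 hx
      · exact h3 _ (Or.inl rfl) _ (Or.inr hx) rfl
    have hl : (x : ℕ) ≠ n - 1 := by
      intro hl
      have : x = ⟨n - 1, by omega⟩ := Fin.ext hl
      rw [this] at hx
      rcases hx with hx | hx
      · exact h3 _ (Or.inr hx) _ (Or.inl rfl) rfl
      · exact h2 hx
    omega
  · have := hall x
    simp [Fin.ext_iff] at this
    grind

theorem IsUpDownCycle.conj_alpha {hn : 2 ≤ n} {s : BraidGroup n} {u d : List (Fin n)}
    (hs : IsSimple s) (h : IsUpDownCycle hn (perm s) u d) :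
    (alpha d)⁻¹ * s * alpha d = delta n := by
  obtain ⟨w, hw⟩ := h.exists_upDownWord
  have : s = wordBraid w := hs.eq_of_perm_eq hw.isSimple
    (h.2.2.2.2.trans (hw.isUpDownCycle hn).2.2.2.2.symm)
  rw [this, mul_assoc, hw.mul_alpha, inv_mul_cancel_left, delta]

/-! ### Simple conjugates of `δ`. -/

theorem exists_isUpDownCycle_perm_delta (hn : 2 ≤ n) :
    IsSimple (delta n) ∧ ∃ u d, IsUpDownCycle hn (perm (delta n)) u d := by
  have key : ∀ m, 1 ≤ m → m ≤ n - 1 → ∃ w u, UpDownWord (n := n) m w u [] := by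
    intro m hm
    induction m, hm using Nat.le_induction with
    | base => exact fun h => ⟨_, _, UpDownWord.base (by omega)⟩
    | succ m hm ih =>
      intro h
      obtain ⟨w, u, hw⟩ := ih (by omega)
      exact ⟨_, _, hw.up (by omega)⟩
  obtain ⟨w, u, hw⟩ := key (n - 1) (by omega) le_rfl
  -- With no descending entries `α` is trivial, so `mul_alpha` identifies the braid as `δ`.
  have he : wordBraid w = delta n := by simpa [alpha, delta] using hw.mul_alpha
  rw [← he]
  exact ⟨hw.isSimple, u, [], hw.isUpDownCycle hn⟩

/-- Without the letter `k` no strand passes between the positions up to `k` and those beyond, so no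
cycle can contain both `k` and `k + 1`. -/
theorem mem_of_forall_invariant {w : List (Fin (n - 1))} (k : Fin (n - 1))
    (h : (perm (wordBraid w)).SameCycle (lo k) (hi k)) : k ∈ w := by
  by_contra hk
  have inv : ∀ x : Fin n, (x : ℕ) ≤ k → (perm (wordBraid w) x : ℕ) ≤ k := by
    clear h
    induction w with
    | nil => simp
    | cons j w ih =>
      intro x hx
      simp only [List.mem_cons, not_or] at hk
      have : (k : ℕ) ≠ j := fun h => hk.1 (Fin.ext h)
      simp only [wordBraid_cons, perm_mul, perm_gen, Equiv.Perm.mul_apply]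
      apply ih hk.2
      rw [val_adjSwap]
      split_ifs <;> omega
  have inv' : ∀ i : ℕ, (((perm (wordBraid w)) ^ i) (lo k) : ℕ) ≤ k := by
    intro i
    induction i with
    | zero => simp [lo]
    | succ i ih => rw [pow_succ', Equiv.Perm.mul_apply]; exact inv _ ih
  obtain ⟨i, hi'⟩ := h.exists_nat_pow_eq
  have := inv' i
  rw [hi'] at this
  simp [hi] at this

theorem IsUpDownCycle.sameCycle {hn : 2 ≤ n} {π : Equiv.Perm (Fin n)} {u d : List (Fin n)}
    (h : IsUpDownCycle hn π u d) (x y : Fin n) : π.SameCycle x y := by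
  obtain ⟨-, -, hlen, hnd, rfl⟩ := h
  have hall : ∀ x : Fin n, x ∈ (⟨0, by omega⟩ : Fin n) :: u ++ (⟨n - 1, by omega⟩ : Fin n) ::
      d.reverse :=
    hnd.mem_of_length_eq (by simp; omega)
  have h2 : 2 ≤ ((⟨0, by omega⟩ : Fin n) :: u ++ (⟨n - 1, by omega⟩ : Fin n) ::
      d.reverse).length := by simp; omega
  refine (List.isCycle_formPerm hnd h2).sameCycle ?_ ?_ <;>
  · rw [Ne, List.formPerm_apply_mem_eq_self_iff _ hnd _ (hall _)]
    omega

theorem IsSimple.exists_isUpDownCycle_of_isConj (hn : 2 ≤ n) {s : BraidGroup n} (hs : IsSimple s)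
    (h : IsConj (delta n) s) : ∃ u d, IsUpDownCycle hn (perm s) u d := by
  obtain ⟨-, u, d, hδ⟩ := exists_isUpDownCycle_perm_delta hn
  obtain ⟨w, rfl, -⟩ := hs
  have hexp := expo_eq_of_isConj h
  change _ = expo (wordBraid w) at hexp
  rw [expo_delta (by omega), expo_wordBraid] at hexp
  obtain ⟨c, hc⟩ := isConj_iff.1 h
  change _ = wordBraid w at hc
  have hall : ∀ k, k ∈ w := by
    intro k
    apply mem_of_forall_invariant
    have hp : perm (wordBraid w) = (perm c)⁻¹ * perm (delta n) * ((perm c)⁻¹)⁻¹ := by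
      have h1 : perm c * perm c⁻¹ = 1 := by rw [← perm_mul]; simp
      rw [← hc, perm_mul, perm_mul, eq_inv_of_mul_eq_one_right h1, inv_inv, mul_assoc]
    rw [hp, Equiv.Perm.sameCycle_conj]
    exact hδ.sameCycle _ _
  -- The word has `n - 1` letters by its exponent sum, and all `n - 1` generators occur.
  have hnd : w.Nodup := by
    rw [← Multiset.coe_nodup, ← Multiset.toFinset_card_eq_card_iff_nodup]
    have : (w : Multiset (Fin (n - 1))).toFinset = Finset.univ := by ext k; simp [hall k]
    rw [this, Finset.card_univ, Fintype.card_fin, Multiset.coe_card]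
    omega
  obtain ⟨w', u', d', hw', he⟩ := exists_upDownWord_of_nodup (n - 1) (by omega) le_rfl w hnd
    fun k => by simp [hall k]
  change ∃ u d, IsUpDownCycle hn (perm (wordBraid w)) u d
  rw [← he]
  exact ⟨u', d', hw'.isUpDownCycle hn⟩

/-! ### The ultra summit set of `δ`. -/

theorem lt_expo_garside (hn : 3 ≤ n) : expo (delta n) < expo (garside n) := by
  have h1 := two_mul_expo_garside (n := n) (by omega)
  rw [expo_delta (by omega)]
  have : (3 : ℤ) ≤ n := by exact_mod_cast hn
  nlinarith

theorem one_le_expo_delta (hn : 2 ≤ n) : 1 ≤ expo (delta n) := by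
  rw [expo_delta (by omega)]
  omega

theorem IsSimple.mem_positive {s : BraidGroup n} (hs : IsSimple s) : s ∈ positive n := by
  obtain ⟨w, rfl, -⟩ := hs
  exact wordBraid_mem_positive w

/-- Prefixes have smaller or equal exponent sum, so no positive power of `Δ` is a prefix of `s`. -/
theorem IsSimple.isLeftNormalForm_singleton (hn : 3 ≤ n) {s : BraidGroup n} (hs : IsSimple s)
    (he : expo s = expo (delta n)) : IsLeftNormalForm s 0 [s] := by
  have h1 := lt_expo_garside hn
  have h2 := one_le_expo_delta (n := n) (by omega)
  refine ⟨by simp, ⟨?_, ?_⟩, ?_, hs, ?_, ?_, trivial⟩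
  · simpa [IsPrefix] using hs.mem_positive
  · intro q hq
    have := IsPrefix.expo_le hq
    rw [expo_zpow, he] at this
    by_contra! hlt
    nlinarith
  · rintro rfl
    simp at he
    omega
  · simp [IsPrefix]
  · intro y _ hy
    simpa using hy

/-- On at least three strands no conjugate of `δ` is a power of `Δ`. -/
theorem expo_garside_zpow_ne (hn : 3 ≤ n) (q : ℤ) : expo (garside n ^ q) ≠ expo (delta n) := by
  have h1 := lt_expo_garside hn
  have h2 := one_le_expo_delta (n := n) (by omega)
  rw [expo_zpow]
  intro h
  rcases le_or_gt q 0 with hq | hq <;> nlinarith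

theorem IsSimple.eq_one_of_expo_nonpos {x : BraidGroup n} (hx : IsSimple x) (h : expo x ≤ 0) :
    x = 1 := by
  obtain ⟨w, rfl, -⟩ := hx
  change expo (wordBraid w) ≤ 0 at h
  rw [expo_wordBraid] at h
  have : w = [] := List.eq_nil_of_length_eq_zero (by omega)
  simp [this]

theorem mem_USS_delta_iff_of_three_le (hn : 3 ≤ n) (s : BraidGroup n) :
    s ∈ USS (delta n) ↔ IsSimple s ∧ IsConj (delta n) s := by
  have h1 := lt_expo_garside hn
  have h2 := one_le_expo_delta (n := n) (by omega)
  constructor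
  · rintro ⟨hconj, ⟨p, l, hl, hmin⟩, -⟩
    refine ⟨?_, hconj⟩
    have hle := hmin _ _ _ (IsConj.refl _)
      ((exists_isUpDownCycle_perm_delta (by omega)).1.isLeftNormalForm_singleton hn rfl)
    have he := expo_eq_of_isConj hconj
    obtain ⟨hs, -, hw⟩ := hl
    rcases l with _ | ⟨y, _ | ⟨z, l⟩⟩
    · exact absurd (by rw [he, hs]; simp) (expo_garside_zpow_ne hn p)
    · have hy := hw.2.1
      have h3 := hy.two_mul_expo_le
      rw [← two_mul_expo_garside (by omega)] at h3
      have h4 : 0 < expo y := by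
        by_contra! h
        exact hw.1 (IsSimple.eq_one_of_expo_nonpos hy h)
      -- Here `expo (delta n) = p * expo (garside n) + expo y` lies strictly between `0` and `expo
      -- (garside n)`, while `0 < expo y ≤ expo (garside n)`; this excludes `p ≥ 1` and `p ≤ -1`.
      have hp : p = 0 := by
        rw [he, hs] at h1 h2
        simp at h1 h2
        have : p < 1 := by by_contra! h; nlinarith
        have : -1 < p := by
          by_contra! h
          nlinarith
        omega
      rw [hs, hp]
      simpa using hy
    · simp at hle
  · rintro ⟨hs, hconj⟩
    have hnf := hs.isLeftNormalForm_singleton hn (expo_eq_of_isConj hconj).symm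
    -- With `p = 0` and a single factor, cycling returns `s` itself.
    refine ⟨hconj, ⟨0, [s], hnf, ?_⟩, .single (.inr ⟨0, s, [], hnf, by simp⟩)⟩
    intro Z q m hZ hm
    rcases m with _ | ⟨y, m⟩
    · refine absurd ?_ (expo_garside_zpow_ne hn q)
      rw [expo_eq_of_isConj hZ, hm.1]
      simp
    · simp

theorem garside_two : garside 2 = delta 2 := by
  simp [garside, delta, sigmaDown]

theorem mem_USS_delta_two_iff (s : BraidGroup 2) :
    s ∈ USS (delta 2) ↔ IsSimple s ∧ IsConj (delta 2) s := by
  have hδ : delta 2 = gen 0 := by simp [delta, sigmaDown, sigma_of_lt]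
  have heq : IsConj (delta 2) s ↔ s = delta 2 := by
    constructor
    · intro h
      obtain ⟨c, rfl⟩ := isConj_iff.1 h
      -- On two strands the only generator is `δ`, so `δ` is central.
      have hc : c ∈ Subgroup.centralizer {delta 2} := by
        have : (⊤ : Subgroup (BraidGroup 2)) ≤ Subgroup.centralizer {delta 2} := by
          rw [← PresentedGroup.closure_range_of, Subgroup.closure_le]
          rintro _ ⟨k, rfl⟩
          rw [SetLike.mem_coe, Subgroup.mem_centralizer_singleton_iff, hδ]
          rw [Subsingleton.elim (α := Fin 1) k 0]
          rfl
        exact this (Subgroup.mem_top c)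
      rw [Subgroup.mem_centralizer_singleton_iff] at hc
      rw [hc, mul_inv_cancel_right]
    · rintro rfl
      exact IsConj.refl _
  rw [heq]
  constructor
  · rintro ⟨h, -⟩
    rw [heq] at h
    exact ⟨h ▸ (exists_isUpDownCycle_perm_delta le_rfl).1, h⟩
  · rintro ⟨-, rfl⟩
    have hnf : IsLeftNormalForm (delta 2) 1 [] := by
      refine ⟨by simp [garside_two], ⟨by simp [garside_two, IsPrefix], ?_⟩, trivial⟩
      intro q hq
      have := IsPrefix.expo_le hq
      rw [expo_zpow, garside_two, expo_delta (by norm_num)] at this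
      norm_num at this
      exact this
    exact ⟨IsConj.refl _, ⟨1, [], hnf, by simp⟩, .single (.inl ⟨1, hnf, rfl⟩)⟩

theorem mem_USS_delta_iff (hn : 2 ≤ n) (s : BraidGroup n) :
    s ∈ USS (delta n) ↔ IsSimple s ∧ IsConj (delta n) s := by
  rcases hn.eq_or_lt with rfl | hn
  · exact mem_USS_delta_two_iff s
  · exact mem_USS_delta_iff_of_three_le hn s

end ArtinBraid

theorem proposition3p1 (n : ℕ) (hn : 2 ≤ n) (s : ArtinBraid.BraidGroup n) :
    (s ∈ ArtinBraid.USS (ArtinBraid.delta n) ↔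
      ArtinBraid.IsSimple s ∧
        ∃ u d : List (Fin n), ArtinBraid.IsUpDownCycle hn (ArtinBraid.perm s) u d) ∧
    (∀ u d : List (Fin n), ArtinBraid.IsSimple s →
      ArtinBraid.IsUpDownCycle hn (ArtinBraid.perm s) u d →
        (ArtinBraid.alpha d)⁻¹ * s * ArtinBraid.alpha d = ArtinBraid.delta n) := by
  refine ⟨?_, fun u d hs h => h.conj_alpha hs⟩
  rw [ArtinBraid.mem_USS_delta_iff hn]
  refine and_congr_right fun hs => ⟨hs.exists_isUpDownCycle_of_isConj hn, ?_⟩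
  rintro ⟨u, d, h⟩
  rw [← h.conj_alpha hs]
  exact isConj_iff.2 ⟨ArtinBraid.alpha d, by group⟩
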